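/- Let $F$ be a field of characteristic zero and let $E$ be the Grassmann algebra over $F$ of a vector space with basis $e_1,e_2,\dots$, so that $1$ and the monomials $w=e_{i_1}\cdots e_{i_k}$ with $i_1<\dots<i_k$ form a basis of $E$; $k$ is the length of $w$ and $\{e_{i_1},\dots,e_{i_k}\}$ is its support (the monomial $1$ has length $0$ and empty support). Let $m<0<n$ be integers. Let $E_{(m,n)}^{(\infty,\infty)}=\bigoplus_{r\in\mathbb Z}A_r$ be the $\mathbb Z$-grading of $E$ obtained by giving degree $m$ to infinitely many of the generators $e_i$ and degree $n$ to the remaining ones, also infinitely many; the degree of a monomial is the sum of the degrees of its factors, and $A_r$ is the span of the monomials of degree $r$. Suppose that $m\cdot n$ is even and that there are non-negative integers $\alpha,\beta,\alpha',\beta'$ with $$1=\alpha m+\beta n,\qquad -1=\alpha' m+\beta' n,$$ and with $\alpha+\beta$ and $\alpha'+\beta'$ both odd (so that, in particular, $\gcd(m,n)=1$ and the grading has full support; $\alpha+\beta$ and $\alpha'+\beta'$ are not required to be minimal). Then $E_{(m,n)}^{(\infty,\infty)}$ generates the variety $\mathfrak V_1^{\mathbb Z}$ of $\mathbb Z$-graded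 algebras defined by the graded identities $[x_1,x_2,x_3]=[[x_1,x_2],x_3]$, for all degrees of the variables $x_1,x_2,x_3$. That is, in the free associative algebra $F\langle X|\mathbb Z\rangle$ on countably many variables of each degree $g\in\mathbb Z$, the ideal of all $\mathbb Z$-graded polynomial identities of $E_{(m,n)}^{(\infty,\infty)}$ is equal to the $T_{\mathbb Z}$-ideal (two-sided ideal invariant under all graded endomorphisms) generated by these polynomials. Moreover, for every $r\in\mathbb Z$ there is a set of monomials in $A_r$ with pairwise disjoint supports that contains infinitely many monomials of even length and infinitely many monomials of odd length. -/

import Mathlib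

noncomputable section

namespace GradedGrassmann

/-! ### The Grassmann algebra, its canonical basis and the gradings induced by degrees of the
generators -/

/-- The Grassmann algebra `E` of a vector space with basis `e_0, e_1, e_2, …` over `F`. -/
abbrev Grassmann (F : Type*) [Field F] : Type _ := ExteriorAlgebra F (ℕ →₀ F)

/-- The canonical basis `B_E` of the Grassmann algebra, indexed by the supports of its elements:
the finite set `{i₁ < ⋯ < i_k}` indexes the monomial `e_{i₁} ⋯ e_{i_k}` of length `k`. -/
def monomialBasis (F : Type*) [Field F] : Module.Basis (Finset ℕ) F (Grassmann F) :=
  (Finsupp.basisSingleOne (R := F) (ι := ℕ)).ExteriorAlgebra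

/-- The degree of the monomial with support `s`, if the generator `e_i` has degree `d i`. -/
def monomialDegree (d : ℕ → ℤ) (s : Finset ℕ) : ℤ := ∑ i ∈ s, d i

/-- The homogeneous component of degree `r` of the Grassmann algebra, if the generator `e_i` has
degree `d i`: the span of all monomials of degree `r`. -/
def component (F : Type*) [Field F] (d : ℕ → ℤ) (r : ℤ) : Submodule F (Grassmann F) :=
  Submodule.span F {w | ∃ s : Finset ℕ, monomialDegree d s = r ∧ w = monomialBasis F s}

/-- `d` is a choice of degrees of the generators that gives the grading `E_{(m,n)}^{(∞,∞)}`: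
infinitely many generators have degree `m`, infinitely many have degree `n`, and there are
no others. -/
structure IsTwoInduced (d : ℕ → ℤ) (m n : ℤ) : Prop where
  degree_eq : ∀ i, d i = m ∨ d i = n
  infinite_left : {i | d i = m}.Infinite
  infinite_right : {i | d i = n}.Infinite

section Grading

variable (F : Type*) [Field F] (d : ℕ → ℤ)

theorem monomialBasis_mem (s : Finset ℕ) :
    monomialBasis F s ∈ component F d (monomialDegree d s) :=
  Submodule.subset_span ⟨s, rfl, rfl⟩

/-- The monomial indexed by `s` is the product of the generators `e_i`, `i ∈ s`, in increasing
order. -/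
theorem monomialBasis_eq_prod (s : Finset ℕ) :
    monomialBasis F s =
      (List.ofFn fun k : Fin s.card =>
        ExteriorAlgebra.ι F (Finsupp.single (s.orderEmbOfFin rfl k) (1 : F))).prod := by
  rw [monomialBasis, ExteriorAlgebra.basis_apply_ofCard _ rfl, ExteriorAlgebra.ιMulti_family,
    ExteriorAlgebra.ιMulti_apply]
  congr 2

theorem monomialBasis_empty : monomialBasis F ∅ = 1 := by
  rw [monomialBasis_eq_prod]; simp

instance component_gradedMonoid : SetLike.GradedMonoid (component F d) where
  one_mem := by
    rw [← monomialBasis_empty F]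
    simpa [monomialDegree] using monomialBasis_mem F d ∅
  mul_mem := by
    intro i j x y hx hy
    induction hx using Submodule.span_induction with
    | zero => simp
    | add a b _ _ ha hb => rw [add_mul]; exact add_mem ha hb
    | smul c a _ ha => rw [smul_mul_assoc]; exact Submodule.smul_mem _ c ha
    | mem a ha =>
      obtain ⟨s, rfl, rfl⟩ := ha
      induction hy using Submodule.span_induction with
      | zero => simp
      | add a b _ _ ha hb => rw [mul_add]; exact add_mem ha hb
      | smul c a _ ha => rw [mul_smul_comm]; exact Submodule.smul_mem _ c ha
      | mem b hb =>
        obtain ⟨t, rfl, rfl⟩ := hb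
        by_cases h : Disjoint s t
        · have := ExteriorAlgebra.basis_mul_of_disjoint (R := F)
            (Finsupp.basisSingleOne (R := F) (ι := ℕ))
            (Set.powersetCard.ofCard (s := s) rfl) (Set.powersetCard.ofCard (s := t) rfl) h
          have key : monomialDegree d s + monomialDegree d t = monomialDegree d (s ∪ t) := by
            simp [monomialDegree, Finset.sum_union h]
          change monomialBasis F s * monomialBasis F t = _ at this
          rw [this, key]
          refine Submodule.smul_of_tower_mem _ _ ?_
          have h2 := monomialBasis_mem F d (s ∪ t)
          rw [← Finset.disjUnion_eq_union s t h] at h2 ⊢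
          exact h2
        · have := ExteriorAlgebra.basis_mul_of_not_disjoint (R := F)
            (Finsupp.basisSingleOne (R := F) (ι := ℕ))
            (Set.powersetCard.ofCard (s := s) rfl) (Set.powersetCard.ofCard (s := t) rfl) h
          change monomialBasis F s * monomialBasis F t = _ at this
          rw [this]
          exact zero_mem _

/-- The components form a decomposition, so that `E` is a `ℤ`-graded algebra. -/
instance component_gradedAlgebra : GradedAlgebra (component F d) where
  toDecomposition := DirectSum.Decomposition.ofLinearMap (component F d)
    ((monomialBasis F).constr F fun s =>
      DirectSum.lof F ℤ (fun r => component F d r) (monomialDegree d s)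
        ⟨monomialBasis F s, monomialBasis_mem F d s⟩)
    (by
      refine (monomialBasis F).ext fun s => ?_
      simp [Module.Basis.constr_basis])
    (by
      refine DirectSum.linearMap_ext F fun r => LinearMap.ext fun ⟨x, hx⟩ => ?_
      simp only [LinearMap.comp_apply, LinearMap.id_apply, DirectSum.coeLinearMap_lof]
      induction hx using Submodule.span_induction with
      | zero => rw [map_zero]; exact (map_zero _).symm
      | add a b ha' hb' ha hb =>
        rw [map_add, ha, hb, ← map_add]
        rfl
      | smul c a ha' ha =>
        rw [map_smul, ha, ← map_smul]
        rfl
      | mem a ha =>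
        obtain ⟨s, rfl, rfl⟩ := ha
        rw [Module.Basis.constr_basis])

end Grading

/-! ### Graded polynomial identities -/

/-- The free associative algebra `F⟨X|ℤ⟩`; the pair `(g, i)` is the `i`-th variable of
degree `g`. -/
abbrev FreeGraded (F : Type*) [Field F] : Type _ := FreeAlgebra F (ℤ × ℕ)

/-- The variable `x_i^g`, of degree `g`. -/
def var (F : Type*) [Field F] (g : ℤ) (i : ℕ) : FreeGraded F := FreeAlgebra.ι F (g, i)

/-- The component of degree `g` of the free algebra: the span of all monomials of degree `g`. -/
def freeComponent (F : Type*) [Field F] (g : ℤ) : Submodule F (FreeGraded F) :=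
  Submodule.span F {w | ∃ l : List (ℤ × ℕ),
    (l.map Prod.fst).sum = g ∧ w = (l.map (FreeAlgebra.ι F)).prod}

/-- An endomorphism of the free algebra is graded if it maps every component into itself. -/
def IsGradedEnd {F : Type*} [Field F] (φ : FreeGraded F →ₐ[F] FreeGraded F) : Prop :=
  ∀ g : ℤ, ∀ f ∈ freeComponent F g, φ f ∈ freeComponent F g

/-- A `T_ℤ`-ideal: a two-sided ideal invariant under all graded endomorphisms. -/
def IsTIdeal {F : Type*} [Field F] (I : TwoSidedIdeal (FreeGraded F)) : Prop :=
  ∀ φ : FreeGraded F →ₐ[F] FreeGraded F, IsGradedEnd φ → ∀ f ∈ I, φ f ∈ I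

/-- The `T_ℤ`-ideal generated by a set of graded polynomials. -/
def tIdealSpan {F : Type*} [Field F] (S : Set (FreeGraded F)) : TwoSidedIdeal (FreeGraded F) :=
  sInf {I | IsTIdeal I ∧ S ⊆ I}

/-- The ideal `T_ℤ(A)` of the graded polynomial identities of a `ℤ`-graded algebra `A`: the
polynomials that vanish under every substitution of elements of `A` of the right degrees
for the variables. -/
def gradedIdentities {F : Type*} [Field F] {A : Type*} [Ring A] [Algebra F A]
    (𝒜 : ℤ → Submodule F A) [GradedAlgebra 𝒜] : TwoSidedIdeal (FreeGraded F) :=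
  .mk' {f | ∀ a : ℤ × ℕ → A, (∀ x, a x ∈ 𝒜 x.1) → FreeAlgebra.lift F a f = 0}
    (fun a _ => map_zero _)
    (fun hf hg a ha => by rw [map_add, hf a ha, hg a ha, add_zero])
    (fun hf a ha => by rw [map_neg, hf a ha, neg_zero])
    (fun hg a ha => by rw [map_mul, hg a ha, mul_zero])
    (fun hf a ha => by rw [map_mul, hf a ha, zero_mul])

/-- The `ℤ`-graded algebra `A` generates the variety of all `ℤ`-graded algebras that satisfy the
graded identities in `S`: the `T_ℤ`-ideal of the variety, which is the `T_ℤ`-ideal generated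
by `S`, is the ideal of all graded identities of `A`. -/
def GeneratesVarietyOf {F : Type*} [Field F] {A : Type*} [Ring A] [Algebra F A]
    (𝒜 : ℤ → Submodule F A) [GradedAlgebra 𝒜] (S : Set (FreeGraded F)) : Prop :=
  tIdealSpan S = gradedIdentities 𝒜

/-- The polynomials `[x₁, x₂, x₃] = [[x₁, x₂], x₃]`, for all degrees of `x₁`, `x₂`, `x₃`; they define
the variety `𝔙₁`. -/
def tripleCommutators (F : Type*) [Field F] : Set (FreeGraded F) :=
  {f | ∃ a b c : ℤ, f = ⁅⁅var F a 1, var F b 2⁆, var F c 3⁆}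

end GradedGrassmann

end

/-!
In an algebra whose commutators are central, `[a, b] [c, d] = -[a, c] [b, d]`, so the entries of a
product of commutators can be permuted up to sign. Hence every polynomial is, modulo the identity
`[x₁, x₂, x₃]`, a linear combination of normal forms, a commutative monomial times a product of
commutators with distinct entries, and it remains to show that no nontrivial combination `f` of
them is an identity of the Grassmann algebra.

If there are monomials of every degree and both parities of the length outside of any finite set
of generators, substitute for each variable `x` a sum of even monomials with disjoint supports, as
many as `x` has occurrences outside of the commutators in a given normal form `p`, and add an odd
monomial if `x` is an entry of a commutator in `p`. Even monomials are central, odd ones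
anticommute and all of them square to zero, so the value of `p` is a nonzero multiple of a
monomial, while every other normal form with a nonzero value precedes `p` in the lexicographic
order by the commutator entries and then by the outer variables. Hence the coefficients of `f`
vanish by well-founded induction.

For the degrees `m < 0 < n`, a representation `r = x m + y n` may be shifted by multiples of
`(n, -m)`. This makes `x` and `y` positive, and since `n - m` is odd it realizes both parities of
the length `x + y`.
-/

open Function

namespace GradedGrassmann

section CentralCommutators

attribute [local instance] LieRing.ofAssociativeRing LieAlgebra.ofAssociativeAlgebra

variable {X R A : Type*} [CommRing R] [Ring A] [Algebra R A]

/-- The identity `[x₁, x₂, x₃] = 0` of Lie nilpotency of class at most two for an associative ring: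
all commutators are central. -/
def HasCentralCommutators (A : Type*) [Ring A] : Prop :=
  ∀ a b c : A, ⁅⁅a, b⁆, c⁆ = 0

theorem hasCentralCommutators_of_span {s : Set A} (hs : Submodule.span R s = ⊤)
    (h : ∀ a ∈ s, ∀ b ∈ s, ∀ c ∈ s, ⁅⁅a, b⁆, c⁆ = 0) : HasCentralCommutators A := by
  have mem_span (a : A) : a ∈ Submodule.span R s := hs ▸ Submodule.mem_top
  intro a b c
  induction mem_span a using Submodule.span_induction with
  | zero => simp only [zero_lie]
  | add a a' _ _ ha ha' => simp only [add_lie, ha, ha', add_zero]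
  | smul r a _ ha => simp only [smul_lie, ha, smul_zero]
  | mem a ha =>
  induction mem_span b using Submodule.span_induction with
  | zero => simp only [lie_zero, zero_lie]
  | add b b' _ _ hb hb' => simp only [lie_add, add_lie, hb, hb', add_zero]
  | smul r b _ hb => simp only [lie_smul, smul_lie, hb, smul_zero]
  | mem b hb =>
  induction mem_span c using Submodule.span_induction with
  | zero => simp only [lie_zero]
  | add c c' _ _ hc hc' => simp only [lie_add, hc, hc', add_zero]
  | smul r c _ hc => simp only [lie_smul, hc, smul_zero]
  | mem c hc => exact h a ha b hb c hc

namespace HasCentralCommutators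

theorem commute_lie (h : HasCentralCommutators A) (a b c : A) : Commute ⁅a, b⁆ c :=
  sub_eq_zero.mp (h a b c)

theorem lie_mul_lie_eq_neg (h : HasCentralCommutators A) (a b c d : A) :
    ⁅a, b⁆ * ⁅c, d⁆ = -(⁅a, c⁆ * ⁅b, d⁆) := by
  have leibniz : ⁅⁅a, b * c⁆, d⁆ = ⁅a, b⁆ * ⁅c, d⁆ + ⁅⁅a, b⁆, d⁆ * c + ⁅a, c⁆ * ⁅b, d⁆
      + ⁅⁅b, d⁆, ⁅a, c⁆⁆ + b * ⁅⁅a, c⁆, d⁆ := by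
    simp only [Ring.lie_def]; noncomm_ring
  simp only [h _ _ _, zero_mul, mul_zero, add_zero] at leibniz
  exact eq_neg_of_add_eq_zero_left leibniz.symm

end HasCentralCommutators

/-- The product `[x_{j₁}, x_{j₂}] [x_{j₃}, x_{j₄}] ⋯` of the commutators of consecutive pairs of
entries of a list; it is set to zero if the length of the list is odd. -/
def commProd (x : X → A) : List X → A
  | [] => 1
  | [_] => 0
  | i :: j :: l => ⁅x i, x j⁆ * commProd x l

theorem map_commProd {B G : Type*} [Ring B] [FunLike G A B] [RingHomClass G A B] (φ : G)
    (x : X → A) : ∀ l : List X, φ (commProd x l) = commProd (fun i => φ (x i)) l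
  | [] => map_one φ
  | [_] => map_zero φ
  | i :: j :: l => by
    simp only [commProd, map_mul, map_commProd φ x l, Ring.lie_def, map_sub]

theorem commProd_of_odd (x : X → A) : ∀ l : List X, Odd l.length → commProd x l = 0
  | [], h => by simp at h
  | [_], _ => rfl
  | i :: j :: l, h => by
    have hl : Odd l.length := by
      simp only [List.length_cons] at h
      grind
    rw [commProd, commProd_of_odd x l hl, mul_zero]

namespace HasCentralCommutators

variable (h : HasCentralCommutators A) (x : X → A)
include h

theorem commProd_append_swap (i j : X) (l : List X) :
    ∀ k : List X, commProd x (k ++ i :: j :: l) = -commProd x (k ++ j :: i :: l)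
  | [] => by rw [List.nil_append, List.nil_append, commProd, commProd, ← lie_skew, neg_mul]
  | [i₀] => by
    cases l with
    | nil => simp only [List.singleton_append, commProd, mul_zero, neg_zero]
    | cons j₀ l =>
      simp only [List.cons_append, List.nil_append, commProd]
      rw [← mul_assoc, h.lie_mul_lie_eq_neg, neg_mul, mul_assoc]
  | i₀ :: j₀ :: k => by
    simp only [List.cons_append, commProd]
    rw [commProd_append_swap i j l k, mul_neg]

theorem exists_commProd_append_eq_of_perm {l l' : List X} (hl : l.Perm l') :
    ∀ k : List X, ∃ ε : ℤˣ, commProd x (k ++ l) = ε • commProd x (k ++ l') := by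
  induction hl with
  | nil => exact fun _ => ⟨1, (one_smul _ _).symm⟩
  | cons i _ ih => exact fun k => by simpa using ih (k ++ [i])
  | swap i j l => exact fun k => ⟨-1, by rw [h.commProd_append_swap x, Units.neg_smul, one_smul]⟩
  | trans _ _ ih ih' =>
    intro k
    obtain ⟨ε, hε⟩ := ih k
    obtain ⟨ε', hε'⟩ := ih' k
    exact ⟨ε * ε', by rw [hε, hε', mul_smul]⟩

theorem exists_commProd_eq_of_perm {l l' : List X} (hl : l.Perm l') :
    ∃ ε : ℤˣ, commProd x l = ε • commProd x l' :=
  h.exists_commProd_append_eq_of_perm x hl []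

theorem commProd_of_not_nodup {l : List X} (hl : ¬ l.Nodup) : commProd x l = 0 := by
  obtain ⟨i, hi⟩ : ∃ i, List.Sublist [i, i] l := by simpa [List.nodup_iff_sublist] using hl
  obtain ⟨k, hk⟩ := hi.exists_perm_append
  obtain ⟨ε, hε⟩ := h.exists_commProd_eq_of_perm x hk
  rw [hε, List.cons_append, List.cons_append, commProd, lie_self, zero_mul, smul_zero]

end HasCentralCommutators

/-- The indices `(J, a)` of the normal forms: `J` is the set of the variables that occur in the
commutators and `a` the multiset of the variables that occur outside of them. -/
abbrev NormalIndex (X : Type*) : Type _ := {J : Finset X // Even J.card} × Multiset X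

/-- The normal forms `x_{i₁} ⋯ x_{i_k} [x_{j₁}, x_{j₂}] ⋯ [x_{j_{2l-1}}, x_{j_{2l}}]` modulo the
identity `[x₁, x₂, x₃]`. Both the factors `x_i` and the entries of the commutators are listed in an
arbitrary order, which is fixed by the choice in `Multiset.toList`. -/
noncomputable def normalForm (x : X → A) (p : NormalIndex X) : A :=
  (p.2.toList.map x).prod * commProd x p.1.1.toList

theorem map_normalForm {B G : Type*} [Ring B] [FunLike G A B] [RingHomClass G A B] (φ : G)
    (x : X → A) (p : NormalIndex X) :
    φ (normalForm x p) = normalForm (fun i => φ (x i)) p := by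
  simp only [normalForm, map_mul, map_list_prod, List.map_map, map_commProd]
  rfl

/-- The span of the products of fewer than `N` of the elements `x i` with a product of
commutators, the filtration along which words are reduced to normal forms. -/
def shortWordSpan (R : Type*) [CommRing R] [Algebra R A] (x : X → A) (N : ℕ) : Submodule R A :=
  Submodule.span R {w | ∃ l L : List X, l.length < N ∧ w = (l.map x).prod * commProd x L}

theorem shortWordSpan_mono (x : X → A) : Monotone (shortWordSpan R x) := by
  refine fun N N' hN => Submodule.span_mono ?_
  rintro _ ⟨l, L, hl, rfl⟩
  exact ⟨l, L, hl.trans_le hN, rfl⟩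

theorem mul_mem_shortWordSpan {x : X → A} {N : ℕ} {w : A} (hw : w ∈ shortWordSpan R x N) (i : X) :
    x i * w ∈ shortWordSpan R x (N + 1) := by
  suffices h : shortWordSpan R x N ≤ (shortWordSpan R x (N + 1)).comap (LinearMap.mulLeft R (x i))
    from h hw
  refine Submodule.span_le.mpr ?_
  rintro _ ⟨l, L, hl, rfl⟩
  exact Submodule.subset_span ⟨i :: l, L, by simpa using hl, by simp [mul_assoc]⟩

namespace HasCentralCommutators

variable (h : HasCentralCommutators A) (x : X → A)
include h

theorem prod_sub_prod_mem_shortWordSpan {l l' : List X} (hl : l.Perm l') (L : List X) :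
    (l.map x).prod * commProd x L - (l'.map x).prod * commProd x L ∈
      shortWordSpan R x l.length := by
  induction hl with
  | nil => simp
  | @cons i l l' _ ih => simpa [mul_sub, mul_assoc] using mul_mem_shortWordSpan ih i
  | swap i j l =>
    refine Submodule.subset_span ⟨l, j :: i :: L, by simp, ?_⟩
    simp only [List.map_cons, List.prod_cons, commProd]
    rw [← mul_assoc (l.map x).prod, ← (h.commute_lie (x j) (x i) _).eq, Ring.lie_def]
    noncomm_ring
  | trans hl _ ih ih' =>
    rw [← hl.length_eq] at ih'
    simpa using add_mem ih ih'

theorem toList_prod_mul_commProd_mem_span_normalForm (a : Multiset X) (L : List X) :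
    (a.toList.map x).prod * commProd x L ∈ Submodule.span R (Set.range (normalForm x)) := by
  classical
  rcases Nat.even_or_odd L.length with hL | hL
  swap
  · simp [commProd_of_odd x L hL]
  by_cases hd : L.Nodup
  swap
  · simp [h.commProd_of_not_nodup x hd]
  have hJ : Even L.toFinset.card := by rwa [List.toFinset_card_of_nodup hd]
  obtain ⟨ε, hε⟩ := h.exists_commProd_eq_of_perm x (List.toFinset_toList hd).symm
  rw [hε, mul_smul_comm]
  exact Submodule.smul_of_tower_mem _ ε (Submodule.subset_span ⟨(⟨L.toFinset, hJ⟩, a), rfl⟩)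

theorem shortWordSpan_le_span_normalForm (N : ℕ) :
    shortWordSpan R x N ≤ Submodule.span R (Set.range (normalForm x)) := by
  induction N with
  | zero =>
    refine Submodule.span_le.mpr ?_
    rintro _ ⟨l, L, hl, -⟩
    exact absurd hl (Nat.not_lt_zero _)
  | succ N ih =>
    refine Submodule.span_le.mpr ?_
    rintro _ ⟨l, L, hl, rfl⟩
    have hperm : l.Perm (l : Multiset X).toList :=
      Multiset.coe_eq_coe.mp (Multiset.coe_toList (l : Multiset X)).symm
    have hdiff := ih <| shortWordSpan_mono x (Nat.le_of_lt_succ hl)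
      (h.prod_sub_prod_mem_shortWordSpan (R := R) x hperm L)
    simpa using add_mem hdiff (h.toList_prod_mul_commProd_mem_span_normalForm x l L)

end HasCentralCommutators

theorem span_range_prod_ι_eq_top (R X : Type*) [CommRing R] :
    Submodule.span R (Set.range fun l : List X => (l.map (FreeAlgebra.ι R)).prod) = ⊤ := by
  rw [← Algebra.top_toSubmodule, ← FreeAlgebra.adjoin_range_ι, Algebra.adjoin_eq_span,
    ← FreeMonoid.mrange_lift, MonoidHom.coe_mrange]
  exact congrArg (fun f : FreeMonoid X → FreeAlgebra R X => Submodule.span R (Set.range f))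
    (funext fun l => (FreeMonoid.lift_apply _ l).symm)

theorem HasCentralCommutators.lift_mem_span_normalForm (h : HasCentralCommutators A) (x : X → A)
    (f : FreeAlgebra R X) :
    FreeAlgebra.lift R x f ∈ Submodule.span R (Set.range (normalForm x)) := by
  have hf : f ∈ Submodule.span R (Set.range fun l : List X => (l.map (FreeAlgebra.ι R)).prod) :=
    span_range_prod_ι_eq_top R X ▸ Submodule.mem_top
  induction hf using Submodule.span_induction with
  | zero => rw [map_zero]; exact zero_mem _
  | add f g _ _ hf hg => rw [map_add]; exact add_mem hf hg
  | smul r f _ hf => rw [map_smul]; exact Submodule.smul_mem _ r hf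
  | mem f hf =>
    obtain ⟨l, rfl⟩ := hf
    refine h.shortWordSpan_le_span_normalForm x (l.length + 1) (Submodule.subset_span ⟨l, [], ?_⟩)
    simp [commProd, map_list_prod, Function.comp_def]

end CentralCommutators

section Evaluation

variable {X A : Type*} [Ring A] {q : X → A}

theorem mul_prod_eq_of_anticommute (hq : ∀ i j, q i * q j = -(q j * q i)) (i : X) (l : List X) :
    q i * (l.map q).prod = (-1) ^ l.length * ((l.map q).prod * q i) := by
  induction l with
  | nil => simp
  | cons j l ih =>
    have hcomm : q j * (-1) ^ l.length = (-1) ^ l.length * q j :=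
      (((Commute.one_left _).neg_left).pow_left _).symm
    rw [List.map_cons, List.prod_cons, List.length_cons, ← mul_assoc, hq, neg_mul, mul_assoc, ih,
      ← mul_assoc, hcomm, pow_succ]
    noncomm_ring

theorem prod_mul_prod_eq_of_anticommute (hq : ∀ i j, q i * q j = -(q j * q i)) (l l' : List X) :
    (l.map q).prod * (l'.map q).prod =
      (-1) ^ (l.length * l'.length) * ((l'.map q).prod * (l.map q).prod) := by
  induction l with
  | nil => simp
  | cons i l ih =>
    have hcomm : q i * (-1) ^ (l.length * l'.length) = (-1) ^ (l.length * l'.length) * q i :=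
      (((Commute.one_left _).neg_left).pow_left _).symm
    rw [List.map_cons, List.prod_cons, List.length_cons, mul_assoc, ih, ← mul_assoc, hcomm,
      mul_assoc, ← mul_assoc (q i), mul_prod_eq_of_anticommute hq, add_mul, one_mul, pow_add]
    simp only [mul_assoc]

theorem mul_prod_eq_zero_of_mem (hq : ∀ i j, q i * q j = -(q j * q i))
    (hq_sq : ∀ i, q i * q i = 0) {i : X} : ∀ {l : List X}, i ∈ l → q i * (l.map q).prod = 0
  | j :: l, h => by
    rw [List.map_cons, List.prod_cons, ← mul_assoc]
    rcases List.mem_cons.mp h with rfl | h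
    · rw [hq_sq, zero_mul]
    · rw [hq, neg_mul, mul_assoc, mul_prod_eq_zero_of_mem hq hq_sq h, mul_zero, neg_zero]

variable (p : X → Subring.center A)

theorem lie_center_add_center_add (hq : ∀ i j, q i * q j = -(q j * q i)) (i j : X) :
    ⁅(p i : A) + q i, p j + q j⁆ = 2 • (q i * q j) := by
  have hi := Subring.mem_center_iff.mp (p i).2
  have hj := Subring.mem_center_iff.mp (p j).2
  rw [Ring.lie_def, add_mul, mul_add, mul_add, add_mul, mul_add, mul_add, ← hi (p j), ← hi (q j),
    hj (q i), hq j i]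
  abel

theorem commProd_center_add (hq : ∀ i j, q i * q j = -(q j * q i)) : ∀ l : List X, Even l.length →
    commProd (fun i => (p i : A) + q i) l = 2 ^ (l.length / 2) • (l.map q).prod
  | [], _ => by simp [commProd]
  | [_], h => by simp at h
  | i :: j :: l, h => by
    have hl : Even l.length := by
      simp only [List.length_cons] at h
      grind
    rw [commProd, lie_center_add_center_add p hq, commProd_center_add hq l hl, smul_mul_smul_comm,
      List.map_cons, List.map_cons, List.prod_cons, List.prod_cons, mul_assoc, List.length_cons,
      List.length_cons, show (l.length + 1 + 1) / 2 = l.length / 2 + 1 by omega, pow_succ']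

theorem prod_center_add_mul_prod (hq : ∀ i j, q i * q j = -(q j * q i))
    (hq_sq : ∀ i, q i * q i = 0) {L : List X} (hL : ∀ i ∉ L, q i = 0) (l : List X) :
    (l.map fun i => (p i : A) + q i).prod * (L.map q).prod =
      (l.map p).prod * (L.map q).prod := by
  induction l with
  | nil => simp
  | cons i l ih =>
    have hcenter := Subring.mem_center_iff.mp (l.map p).prod.2
    have hzero : q i * (L.map q).prod = 0 := by
      by_cases hi : i ∈ L
      · exact mul_prod_eq_zero_of_mem hq hq_sq hi
      · rw [hL i hi, zero_mul]
    simp only [List.map_cons, List.prod_cons, Subring.coe_mul]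
    rw [mul_assoc, ih, add_mul, ← mul_assoc (q i), hcenter, mul_assoc _ (q i), hzero, mul_zero,
      add_zero, mul_assoc]

theorem normalForm_center_add_eq (hq : ∀ i j, q i * q j = -(q j * q i))
    (hq_sq : ∀ i, q i * q i = 0) (J : {J : Finset X // Even J.card}) (hJ : ∀ i ∉ J.1, q i = 0)
    (a : Multiset X) :
    normalForm (fun i => (p i : A) + q i) (J, a) =
      2 ^ (J.1.card / 2) • ((a.map p).prod * (J.1.toList.map q).prod : A) := by
  have hprod : (a.map p).prod = (a.toList.map p).prod := by
    conv_lhs => rw [← Multiset.coe_toList a, Multiset.map_coe, Multiset.prod_coe]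
  rw [normalForm, commProd_center_add p hq _ (by simpa using J.2), mul_smul_comm,
    prod_center_add_mul_prod p hq hq_sq (by simpa using hJ), hprod, Finset.length_toList]

theorem normalForm_center_add_eq_zero (hq : ∀ i j, q i * q j = -(q j * q i))
    (J : {J : Finset X // Even J.card}) {i : X} (hi : i ∈ J.1) (hqi : q i = 0) (a : Multiset X) :
    normalForm (fun i => (p i : A) + q i) (J, a) = 0 := by
  have hprod : (J.1.toList.map q).prod = 0 :=
    List.prod_eq_zero (List.mem_map.mpr ⟨i, Finset.mem_toList.mpr hi, hqi⟩)
  rw [normalForm, commProd_center_add p hq _ (by simpa using J.2), hprod, smul_zero, mul_zero]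

end Evaluation

section SquareZero

variable {ι A : Type*} [CommSemiring A] {w : ι → A}

theorem prod_mul_sum_eq_zero_of_sq_zero (hw : ∀ i, w i * w i = 0) (s : Finset ι) :
    (∏ i ∈ s, w i) * ∑ i ∈ s, w i = 0 := by
  classical
  rw [Finset.mul_sum]
  refine Finset.sum_eq_zero fun i hi => ?_
  rw [← Finset.mul_prod_erase s w hi, mul_right_comm, hw, zero_mul]

theorem sum_pow_card_of_sq_zero (hw : ∀ i, w i * w i = 0) (s : Finset ι) :
    (∑ i ∈ s, w i) ^ s.card = s.card.factorial * ∏ i ∈ s, w i := by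
  classical
  induction s using Finset.induction_on with
  | empty => simp
  | insert i s hi ih =>
    obtain ⟨k, hk⟩ := Polynomial.powAddExpansion (∑ i ∈ s, w i) (w i) (s.card + 1)
    rw [Finset.sum_insert hi, Finset.prod_insert hi, Finset.card_insert_of_notMem hi,
      add_comm (w i), hk, pow_succ, Nat.add_sub_cancel, ih, mul_assoc _ (∏ i ∈ s, w i),
      prod_mul_sum_eq_zero_of_sq_zero hw, sq, hw, Nat.factorial_succ, Nat.cast_mul]
    ring

theorem sum_pow_eq_zero_of_sq_zero (hw : ∀ i, w i * w i = 0) {s : Finset ι} {k : ℕ}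
    (hk : s.card < k) : (∑ i ∈ s, w i) ^ k = 0 := by
  refine pow_eq_zero_of_le hk ?_
  rw [pow_succ, sum_pow_card_of_sq_zero hw, mul_assoc, prod_mul_sum_eq_zero_of_sq_zero hw, mul_zero]

end SquareZero

theorem eq_zero_of_linearCombination_triangular {ι R M : Type*} [Ring R] [IsDomain R]
    [AddCommGroup M] [Module R M] [Module.IsTorsionFree R M] {r : ι → ι → Prop}
    (hr : WellFounded r) {v : ι → ι → M} (hv : ∀ i j, j ≠ i → v i j ≠ 0 → r j i)
    (hv_self : ∀ i, v i i ≠ 0) {c : ι →₀ R} (hc : ∀ i, Finsupp.linearCombination R (v i) c = 0) :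
    c = 0 := by
  ext i
  induction i using hr.induction with
  | _ i ih =>
  have hci : Finsupp.linearCombination R (v i) c = c i • v i i := by
    rw [Finsupp.linearCombination_apply]
    refine Finsupp.sum_eq_single i (fun j _ hj => ?_) fun _ => zero_smul _ _
    by_cases hvj : v i j = 0
    · rw [hvj, smul_zero]
    · rw [ih j (hv i j hj hvj), Finsupp.zero_apply, zero_smul]
  exact (smul_eq_zero.mp (hci.symm.trans (hc i))).resolve_right (hv_self i)

section Monomials

variable {F : Type*} [Field F]

theorem monomialBasis_mul_of_not_disjoint {s t : Finset ℕ} (h : ¬ Disjoint s t) :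
    monomialBasis F s * monomialBasis F t = 0 :=
  ExteriorAlgebra.basis_mul_of_not_disjoint (Finsupp.basisSingleOne (R := F) (ι := ℕ))
    (Set.powersetCard.ofCard (s := s) rfl) (Set.powersetCard.ofCard (s := t) rfl) h

theorem monomialBasis_mul_self {s : Finset ℕ} (hs : s.Nonempty) :
    monomialBasis F s * monomialBasis F s = 0 :=
  monomialBasis_mul_of_not_disjoint fun h => hs.ne_empty (disjoint_self.mp h)

theorem exists_monomialBasis_mul {s t : Finset ℕ} (h : Disjoint s t) :
    ∃ ε : ℤˣ, monomialBasis F s * monomialBasis F t = ε • monomialBasis F (s ∪ t) := by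
  rw [← Finset.disjUnion_eq_union s t h]
  exact ⟨_, ExteriorAlgebra.basis_mul_of_disjoint (Finsupp.basisSingleOne (R := F) (ι := ℕ))
    (Set.powersetCard.ofCard (s := s) rfl) (Set.powersetCard.ofCard (s := t) rfl) h⟩

theorem monomialBasis_mul_comm (s t : Finset ℕ) :
    monomialBasis F s * monomialBasis F t =
      (-1) ^ (s.card * t.card) * (monomialBasis F t * monomialBasis F s) := by
  have eq_prod (s : Finset ℕ) : monomialBasis F s =
      ((List.ofFn fun k => Finsupp.single (s.orderEmbOfFin rfl k) (1 : F)).map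
        (ExteriorAlgebra.ι F)).prod := by
    rw [monomialBasis_eq_prod, List.map_ofFn, Function.comp_def]
  rw [eq_prod s, eq_prod t, prod_mul_prod_eq_of_anticommute fun v w =>
    eq_neg_of_add_eq_zero_left (ExteriorAlgebra.ι_add_mul_swap v w), List.length_ofFn,
    List.length_ofFn]

theorem monomialBasis_mem_center {s : Finset ℕ} (hs : Even s.card) :
    monomialBasis F s ∈ Subring.center (Grassmann F) := by
  have mulRight_eq_mulLeft :
      LinearMap.mulRight F (monomialBasis F s) = LinearMap.mulLeft F (monomialBasis F s) := by
    refine (monomialBasis F).ext fun t => ?_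
    rw [LinearMap.mulRight_apply, LinearMap.mulLeft_apply, monomialBasis_mul_comm,
      (hs.mul_left t.card).neg_one_pow, one_mul]
  exact Subring.mem_center_iff.mpr (LinearMap.congr_fun mulRight_eq_mulLeft)

theorem monomialBasis_anticommute {s t : Finset ℕ} (hs : Odd s.card) (ht : Odd t.card) :
    monomialBasis F s * monomialBasis F t = -(monomialBasis F t * monomialBasis F s) := by
  rw [monomialBasis_mul_comm, (hs.mul ht).neg_one_pow, neg_one_mul]

theorem monomialBasis_mul_mem_center {s t : Finset ℕ} (hs : Odd s.card) (ht : Odd t.card) :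
    monomialBasis F s * monomialBasis F t ∈ Subring.center (Grassmann F) := by
  by_cases hd : Disjoint s t
  · obtain ⟨ε, hε⟩ := exists_monomialBasis_mul (F := F) hd
    have hcard : Even (s ∪ t).card := by
      rw [Finset.card_union_of_disjoint hd]
      exact hs.add_odd ht
    rw [hε]
    exact zsmul_mem (monomialBasis_mem_center hcard) (ε : ℤ)
  · rw [monomialBasis_mul_of_not_disjoint hd]
    exact zero_mem _

theorem lie_monomialBasis_mem_center (s t : Finset ℕ) :
    ⁅monomialBasis F s, monomialBasis F t⁆ ∈ Subring.center (Grassmann F) := by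
  rw [Ring.lie_def]
  rcases Nat.even_or_odd s.card with hs | hs
  · rw [Subring.mem_center_iff.mp (monomialBasis_mem_center hs), sub_self]
    exact zero_mem _
  rcases Nat.even_or_odd t.card with ht | ht
  · rw [Subring.mem_center_iff.mp (monomialBasis_mem_center ht), sub_self]
    exact zero_mem _
  exact sub_mem (monomialBasis_mul_mem_center hs ht) (monomialBasis_mul_mem_center ht hs)

theorem hasCentralCommutators_grassmann (F : Type*) [Field F] :
    HasCentralCommutators (Grassmann F) := by
  refine hasCentralCommutators_of_span (monomialBasis F).span_eq ?_
  rintro _ ⟨s, rfl⟩ _ ⟨t, rfl⟩ c -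
  rw [Ring.lie_def, Subring.mem_center_iff.mp (lie_monomialBasis_mem_center s t), sub_self]

/-- `z` is a nonzero scalar multiple of the monomial with support `s`. -/
def IsMonomialMultiple (z : Grassmann F) (s : Finset ℕ) : Prop :=
  ∃ c : F, c ≠ 0 ∧ z = c • monomialBasis F s

namespace IsMonomialMultiple

variable {z w : Grassmann F} {s t : Finset ℕ}

theorem monomialBasis (s : Finset ℕ) : IsMonomialMultiple (monomialBasis F s) s :=
  ⟨1, one_ne_zero, (one_smul _ _).symm⟩

theorem ne_zero (hz : IsMonomialMultiple z s) : z ≠ 0 := by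
  obtain ⟨c, hc, rfl⟩ := hz
  exact smul_ne_zero hc ((GradedGrassmann.monomialBasis F).ne_zero s)

theorem nsmul [CharZero F] (hz : IsMonomialMultiple z s) {k : ℕ} (hk : k ≠ 0) :
    IsMonomialMultiple (k • z) s := by
  obtain ⟨c, hc, rfl⟩ := hz
  exact ⟨k • c, smul_ne_zero hk hc, (smul_assoc k c _).symm⟩

theorem mul (hz : IsMonomialMultiple z s) (hw : IsMonomialMultiple w t) (hst : Disjoint s t) :
    IsMonomialMultiple (z * w) (s ∪ t) := by
  obtain ⟨b, hb, rfl⟩ := hz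
  obtain ⟨c, hc, rfl⟩ := hw
  obtain ⟨ε, hε⟩ := exists_monomialBasis_mul (F := F) hst
  refine ⟨(b * c) * ((ε : ℤ) : F), mul_ne_zero (mul_ne_zero hb hc) ?_, ?_⟩
  · rcases Int.units_eq_one_or ε with rfl | rfl <;> simp
  · rw [smul_mul_smul_comm, hε, mul_smul (b * c), Int.cast_smul_eq_zsmul, Units.smul_def]

variable {κ : Type*} {S : κ → Finset ℕ}

theorem list_prod [DecidableEq κ] {z : κ → Grassmann F} (hS : Pairwise (Disjoint on S))
    {l : List κ} (hl : l.Nodup) (hz : ∀ i ∈ l, IsMonomialMultiple (z i) (S i)) :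
    IsMonomialMultiple (l.map z).prod (l.toFinset.biUnion S) := by
  induction l with
  | nil => exact ⟨1, one_ne_zero, by simp [monomialBasis_empty]⟩
  | cons i l ih =>
    rw [List.nodup_cons] at hl
    rw [List.forall_mem_cons] at hz
    rw [List.map_cons, List.prod_cons, List.toFinset_cons, Finset.biUnion_insert]
    refine hz.1.mul (ih hl.2 hz.2) ((Finset.disjoint_biUnion_right _ _ _).mpr fun j hj => hS ?_)
    rintro rfl
    exact hl.1 (List.mem_toFinset.mp hj)

theorem center_prod {z : κ → Subring.center (Grassmann F)} (hS : Pairwise (Disjoint on S))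
    {T : Finset κ} (hz : ∀ i ∈ T, IsMonomialMultiple (z i : Grassmann F) (S i)) :
    IsMonomialMultiple ((∏ i ∈ T, z i : Subring.center (Grassmann F)) : Grassmann F)
      (T.biUnion S) := by
  classical
  have h := list_prod hS T.nodup_toList (by simpa only [Finset.mem_toList] using hz)
  rw [Finset.toList_toFinset] at h
  rw [← Finset.prod_map_toList, ← Subring.coe_subtype, map_list_prod, List.map_map]
  exact h

end IsMonomialMultiple

end Monomials

section SupportSystem

variable {d : ℕ → ℤ}

/-- The generators whose degrees are given by `d` suffice to build monomials of every degree and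
with every parity of the length out of generators outside of any given finite set. -/
def IsAbundant (d : ℕ → ℤ) : Prop :=
  ∀ (r : ℤ) (ε : ZMod 2) (t : Finset ℕ),
    ∃ s : Finset ℕ, Disjoint s t ∧ s.Nonempty ∧ monomialDegree d s = r ∧ (s.card : ZMod 2) = ε

/-- A family of nonempty pairwise disjoint supports that provides each variable `x = (r, i)` of the
free graded algebra with infinitely many monomials of its degree `r` of each parity: `S (ε, x, k)`
is the `k`-th support for `x` among those whose cardinality is `ε` modulo two. -/
structure IsSupportSystem (d : ℕ → ℤ) (S : ZMod 2 × (ℤ × ℕ) × ℕ → Finset ℕ) : Prop where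
  pairwise_disjoint : Pairwise (Disjoint on S)
  nonempty : ∀ k, (S k).Nonempty
  degree_eq : ∀ k, monomialDegree d (S k) = k.2.1.1
  card_eq : ∀ k, ((S k).card : ZMod 2) = k.1

theorem exists_pairwise_disjoint_seq {P : ℕ → Finset ℕ → Prop}
    (hP : ∀ k t, ∃ s, Disjoint s t ∧ P k s) :
    ∃ S : ℕ → Finset ℕ, Pairwise (Disjoint on S) ∧ ∀ k, P k (S k) := by
  choose g hg_disjoint hgP using hP
  let union : ℕ → Finset ℕ := fun k => Nat.rec ∅ (fun j t => t ∪ g j t) k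
  have union_mono : Monotone union := monotone_nat_of_le_succ fun _ => Finset.subset_union_left
  refine ⟨fun k => g k (union k), (pairwise_disjoint_on _).mpr fun i j hij => ?_,
    fun k => hgP k _⟩
  have subset_union : g i (union i) ⊆ union j :=
    Finset.subset_union_right.trans (union_mono (Nat.succ_le_of_lt hij))
  exact ((hg_disjoint j _).mono_right subset_union).symm

theorem exists_pairwise_disjoint {ι : Type*} [Countable ι] {P : ι → Finset ℕ → Prop}
    (hP : ∀ i t, ∃ s, Disjoint s t ∧ P i s) :
    ∃ S : ι → Finset ℕ, Pairwise (Disjoint on S) ∧ ∀ i, P i (S i) := by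
  obtain ⟨e, he⟩ := exists_injective_nat ι
  have hP' (k : ℕ) (t : Finset ℕ) : ∃ s, Disjoint s t ∧ ∀ i, e i = k → P i s := by
    by_cases hk : ∃ i, e i = k
    · obtain ⟨i, rfl⟩ := hk
      obtain ⟨s, hst, hs⟩ := hP i t
      exact ⟨s, hst, fun j hj => he hj ▸ hs⟩
    · exact ⟨∅, Finset.disjoint_empty_left t, fun i hi => absurd ⟨i, hi⟩ hk⟩
  obtain ⟨S, hS_disjoint, hS⟩ := exists_pairwise_disjoint_seq hP'
  exact ⟨S ∘ e, fun _ _ hij => hS_disjoint (he.ne hij), fun i => hS (e i) i rfl⟩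

theorem IsAbundant.exists_isSupportSystem (h : IsAbundant d) : ∃ S, IsSupportSystem d S := by
  obtain ⟨S, hS_disjoint, hS⟩ := exists_pairwise_disjoint
    fun k : ZMod 2 × (ℤ × ℕ) × ℕ => h k.2.1.1 k.1
  exact ⟨S, hS_disjoint, fun k => (hS k).1, fun k => (hS k).2.1, fun k => (hS k).2.2⟩

namespace IsSupportSystem

variable {S : ZMod 2 × (ℤ × ℕ) × ℕ → Finset ℕ}

theorem even_card (hS : IsSupportSystem d S) (x : ℤ × ℕ) (k : ℕ) : Even (S (0, x, k)).card :=
  (ZMod.natCast_eq_zero_iff_even).mp (hS.card_eq _)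

theorem odd_card (hS : IsSupportSystem d S) (x : ℤ × ℕ) (k : ℕ) : Odd (S (1, x, k)).card :=
  (ZMod.natCast_eq_one_iff_odd).mp (hS.card_eq _)

theorem monomialBasis_mem_component (hS : IsSupportSystem d S) (F : Type*) [Field F]
    (ε : ZMod 2) (x : ℤ × ℕ) (k : ℕ) : monomialBasis F (S (ε, x, k)) ∈ component F d x.1 :=
  hS.degree_eq (ε, x, k) ▸ monomialBasis_mem F d _

theorem injective (hS : IsSupportSystem d S) : Injective S := by
  intro k l hkl
  by_contra hne
  have hdisj : Disjoint (S k) (S l) := hS.pairwise_disjoint hne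
  rw [hkl, disjoint_self] at hdisj
  exact (hS.nonempty l).ne_empty hdisj

theorem exists_pairwiseDisjoint_infinite (hS : IsSupportSystem d S) (F : Type*) [Field F] (r : ℤ) :
    ∃ W : Set (Finset ℕ), W.PairwiseDisjoint id ∧
      (∀ s ∈ W, monomialBasis F s ∈ component F d r) ∧
      {s ∈ W | Even s.card}.Infinite ∧ {s ∈ W | Odd s.card}.Infinite := by
  have infinite_range (ε : ZMod 2) : (Set.range fun k => S (ε, (r, 0), k)).Infinite :=
    Set.infinite_range_of_injective fun k l hkl => by simpa using hS.injective hkl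
  refine ⟨Set.range fun p : ZMod 2 × ℕ => S (p.1, (r, 0), p.2), ?_, ?_, ?_, ?_⟩
  · rintro _ ⟨p, rfl⟩ _ ⟨q, rfl⟩ hpq
    exact hS.pairwise_disjoint fun h => hpq (congrArg S h)
  · rintro _ ⟨p, rfl⟩
    exact hS.monomialBasis_mem_component F p.1 (r, 0) p.2
  · refine (infinite_range 0).mono ?_
    rintro _ ⟨k, rfl⟩
    exact ⟨⟨(0, k), rfl⟩, hS.even_card _ k⟩
  · refine (infinite_range 1).mono ?_
    rintro _ ⟨k, rfl⟩
    exact ⟨⟨(1, k), rfl⟩, hS.odd_card _ k⟩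

end IsSupportSystem

end SupportSystem

namespace IsSupportSystem

variable {d : ℕ → ℤ} {S : ZMod 2 × (ℤ × ℕ) × ℕ → Finset ℕ}

section Substitution

variable (F : Type*) [Field F] (hS : IsSupportSystem d S)

/-- The even monomial with support `S (0, x, k)`, as a central element. -/
noncomputable def evenMonomial (x : ℤ × ℕ) (k : ℕ) : Subring.center (Grassmann F) :=
  ⟨monomialBasis F (S (0, x, k)), monomialBasis_mem_center (hS.even_card x k)⟩

/-- The central part of the substitution that detects a normal form with outer variables `a`: the
variable `x` takes as a value the sum of as many even monomials as `x` has occurrences in `a`. -/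
noncomputable def centralValue (a : Multiset (ℤ × ℕ)) (x : ℤ × ℕ) : Subring.center (Grassmann F) :=
  ∑ k ∈ Finset.range (a.count x), hS.evenMonomial F x k

/-- The anticommuting part of the substitution that detects a normal form whose commutators have
the entries `J`: an odd monomial for each of the variables in `J` and zero for the others. -/
noncomputable def oddValue (S : ZMod 2 × (ℤ × ℕ) × ℕ → Finset ℕ) (J : Finset (ℤ × ℕ)) (x : ℤ × ℕ) :
    Grassmann F :=
  if x ∈ J then monomialBasis F (S (1, x, 0)) else 0

/-- The homogeneous substitution that detects the normal form with index `p`. -/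
noncomputable def substitution (p : NormalIndex (ℤ × ℕ)) (x : ℤ × ℕ) : Grassmann F :=
  hS.centralValue F p.2 x + oddValue F S p.1.1 x

variable {F}
include hS

theorem substitution_mem_component (p : NormalIndex (ℤ × ℕ)) (x : ℤ × ℕ) :
    hS.substitution F p x ∈ component F d x.1 := by
  refine add_mem ?_ ?_
  · rw [centralValue, AddSubmonoidClass.coe_finsetSum]
    exact sum_mem fun k _ => hS.monomialBasis_mem_component F 0 x k
  · rw [oddValue]
    split_ifs
    · exact hS.monomialBasis_mem_component F 1 x 0
    · exact zero_mem _

theorem evenMonomial_mul_self (x : ℤ × ℕ) (k : ℕ) :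
    hS.evenMonomial F x k * hS.evenMonomial F x k = 0 :=
  Subtype.ext (monomialBasis_mul_self (hS.nonempty _))

theorem oddValue_anticommute (J : Finset (ℤ × ℕ)) (x y : ℤ × ℕ) :
    oddValue F S J x * oddValue F S J y = -(oddValue F S J y * oddValue F S J x) := by
  rw [oddValue, oddValue]
  split_ifs
  · exact monomialBasis_anticommute (hS.odd_card x 0) (hS.odd_card y 0)
  all_goals simp only [mul_zero, zero_mul, neg_zero]

theorem oddValue_mul_self (J : Finset (ℤ × ℕ)) (x : ℤ × ℕ) :
    oddValue F S J x * oddValue F S J x = 0 := by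
  rw [oddValue]
  split_ifs
  · exact monomialBasis_mul_self (hS.nonempty _)
  · exact mul_zero 0

theorem normalForm_substitution {J₀ J : {J : Finset (ℤ × ℕ) // Even J.card}} (hJ : J₀.1 ⊆ J.1)
    (a₀ a : Multiset (ℤ × ℕ)) :
    normalForm (hS.substitution F (J₀, a₀)) (J, a) = 2 ^ (J.1.card / 2) •
      ((a.map (hS.centralValue F a₀)).prod * (J.1.toList.map (oddValue F S J₀.1)).prod) :=
  normalForm_center_add_eq _ (hS.oddValue_anticommute _) (hS.oddValue_mul_self _) J
    (fun _ hx => if_neg fun hx₀ => hx (hJ hx₀)) a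

theorem prod_centralValue_eq_zero {a b : Multiset (ℤ × ℕ)} (hba : ¬ b ≤ a) :
    (b.map (hS.centralValue F a)).prod = 0 := by
  obtain ⟨x, hx⟩ : ∃ x, a.count x < b.count x := by
    simpa only [Multiset.le_iff_count, not_forall, not_le] using hba
  have hpow : hS.centralValue F a x ^ b.count x = 0 :=
    sum_pow_eq_zero_of_sq_zero (hS.evenMonomial_mul_self x) ((Finset.card_range _).trans_lt hx)
  have hxb : x ∈ b := Multiset.count_pos.mp (Nat.zero_lt_of_lt hx)
  rw [Finset.prod_multiset_map_count]
  exact Finset.prod_eq_zero (Multiset.mem_toFinset.mpr hxb) hpow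

theorem isMonomialMultiple_prod_oddValue (J : Finset (ℤ × ℕ)) :
    IsMonomialMultiple (J.toList.map (oddValue F S J)).prod (J.biUnion fun x => S (1, x, 0)) := by
  have h := IsMonomialMultiple.list_prod (z := oddValue F S J) (S := fun x => S (1, x, 0))
    (fun x y hxy => hS.pairwise_disjoint (by simpa using hxy)) J.nodup_toList fun x hx => by
      rw [oddValue, if_pos (Finset.mem_toList.mp hx)]
      exact .monomialBasis _
  rwa [Finset.toList_toFinset] at h

theorem lex_lt_of_normalForm_substitution_ne_zero {p₀ p : NormalIndex (ℤ × ℕ)} (hp : p ≠ p₀)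
    (hne : normalForm (hS.substitution F p₀) p ≠ 0) : Prod.Lex (· < ·) (· < ·) p p₀ := by
  obtain ⟨J₀, a₀⟩ := p₀
  obtain ⟨J, a⟩ := p
  have hJ : J ≤ J₀ := by
    by_contra hJ
    obtain ⟨x, hx, hx₀⟩ := Finset.not_subset.mp hJ
    exact hne (normalForm_center_add_eq_zero _ (hS.oddValue_anticommute _) J hx (if_neg hx₀) a)
  rcases hJ.lt_or_eq with hJ | rfl
  · exact .left _ _ hJ
  have ha : a ≤ a₀ := by
    by_contra ha
    refine hne ?_
    rw [hS.normalForm_substitution subset_rfl, hS.prod_centralValue_eq_zero ha,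
      ZeroMemClass.coe_zero, zero_mul, smul_zero]
  exact .right _ (ha.lt_of_ne fun h => hp (h ▸ rfl))

variable [CharZero F]

theorem isMonomialMultiple_centralValue_pow (a : Multiset (ℤ × ℕ)) (x : ℤ × ℕ) :
    IsMonomialMultiple (hS.centralValue F a x ^ a.count x : Grassmann F)
      ((Finset.range (a.count x)).biUnion fun k => S (0, x, k)) := by
  have hpow := sum_pow_card_of_sq_zero (hS.evenMonomial_mul_self (F := F) x)
    (Finset.range (a.count x))
  rw [Finset.card_range, ← nsmul_eq_mul] at hpow
  rw [← Subring.coe_pow, centralValue, hpow]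
  refine (IsMonomialMultiple.center_prod (S := fun k => S (0, x, k)) (fun k l hkl => ?_)
    fun k _ => .monomialBasis _).nsmul (Nat.factorial_ne_zero _)
  exact hS.pairwise_disjoint (by simpa using hkl)

theorem isMonomialMultiple_prod_centralValue (a : Multiset (ℤ × ℕ)) :
    IsMonomialMultiple ((a.map (hS.centralValue F a)).prod : Grassmann F)
      (a.toFinset.biUnion fun x => (Finset.range (a.count x)).biUnion fun k => S (0, x, k)) := by
  rw [Finset.prod_multiset_map_count]
  refine IsMonomialMultiple.center_prod (fun x y hxy => ?_)
    fun x _ => hS.isMonomialMultiple_centralValue_pow a x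
  simp only [onFun, Finset.disjoint_biUnion_left, Finset.disjoint_biUnion_right]
  exact fun _ _ _ _ => hS.pairwise_disjoint (by simp [hxy])

theorem normalForm_substitution_self_ne_zero (p : NormalIndex (ℤ × ℕ)) :
    normalForm (hS.substitution F p) p ≠ 0 := by
  obtain ⟨J, a⟩ := p
  rw [hS.normalForm_substitution subset_rfl]
  have hmul := (hS.isMonomialMultiple_prod_centralValue (F := F) a).mul
    (hS.isMonomialMultiple_prod_oddValue J.1) <| by
      simp only [Finset.disjoint_biUnion_left, Finset.disjoint_biUnion_right]
      exact fun _ _ _ _ _ _ => hS.pairwise_disjoint (by simp)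
  exact (hmul.nsmul (pow_ne_zero _ two_ne_zero)).ne_zero

theorem eq_zero_of_linearCombination_normalForm (c : NormalIndex (ℤ × ℕ) →₀ F)
    (hc : ∀ u : ℤ × ℕ → Grassmann F, (∀ x, u x ∈ component F d x.1) →
      Finsupp.linearCombination F (normalForm u) c = 0) : c = 0 :=
  eq_zero_of_linearCombination_triangular (WellFounded.prod_lex wellFounded_lt wellFounded_lt)
    (fun _ _ => hS.lex_lt_of_normalForm_substitution_ne_zero)
    hS.normalForm_substitution_self_ne_zero fun p => hc _ (hS.substitution_mem_component p)

end Substitution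

end IsSupportSystem

section GradedIdentities

variable {F A : Type*} [Field F] [Ring A] [Algebra F A]

theorem ι_mem_freeComponent (x : ℤ × ℕ) : FreeAlgebra.ι F x ∈ freeComponent F x.1 :=
  Submodule.subset_span ⟨[x], by simp⟩

instance freeComponent_gradedMonoid : SetLike.GradedMonoid (freeComponent F) where
  one_mem := Submodule.subset_span ⟨[], by simp⟩
  mul_mem g g' f f' hf hf' := by
    have hmul := Submodule.mul_mem_mul hf hf'
    rw [freeComponent, freeComponent, Submodule.span_mul_span] at hmul
    refine Submodule.span_mono ?_ hmul
    rintro _ ⟨_, ⟨l, rfl, rfl⟩, _, ⟨l', rfl, rfl⟩, rfl⟩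
    exact ⟨l ++ l', by simp, by simp⟩

theorem lift_mem_of_mem_freeComponent {𝒜 : ℤ → Submodule F A} [SetLike.GradedMonoid 𝒜]
    {a : ℤ × ℕ → A} (ha : ∀ x, a x ∈ 𝒜 x.1) {g : ℤ} {f : FreeGraded F}
    (hf : f ∈ freeComponent F g) : FreeAlgebra.lift F a f ∈ 𝒜 g := by
  suffices h : freeComponent F g ≤ (𝒜 g).comap (FreeAlgebra.lift F a).toLinearMap from h hf
  refine Submodule.span_le.mpr ?_
  rintro _ ⟨l, rfl, rfl⟩
  simpa [map_list_prod, Function.comp_def] using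
    SetLike.list_prod_map_mem_graded l Prod.fst a fun x _ => ha x

theorem isGradedEnd_lift {v : ℤ × ℕ → FreeGraded F} (hv : ∀ x, v x ∈ freeComponent F x.1) :
    IsGradedEnd (FreeAlgebra.lift F v) :=
  fun _ _ hf => lift_mem_of_mem_freeComponent hv hf

theorem mem_gradedIdentities {𝒜 : ℤ → Submodule F A} [GradedAlgebra 𝒜] {f : FreeGraded F} :
    f ∈ gradedIdentities 𝒜 ↔
      ∀ a : ℤ × ℕ → A, (∀ x, a x ∈ 𝒜 x.1) → FreeAlgebra.lift F a f = 0 := by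
  rw [gradedIdentities, TwoSidedIdeal.mem_mk']
  rfl

theorem isTIdeal_gradedIdentities (𝒜 : ℤ → Submodule F A) [GradedAlgebra 𝒜] :
    IsTIdeal (gradedIdentities 𝒜) := by
  intro φ hφ f hf
  refine mem_gradedIdentities.mpr fun a ha => ?_
  have lift_comp : (FreeAlgebra.lift F a).comp φ =
      FreeAlgebra.lift F fun x => FreeAlgebra.lift F a (φ (FreeAlgebra.ι F x)) := by
    ext x; simp
  rw [← AlgHom.comp_apply, lift_comp]
  exact mem_gradedIdentities.mp hf _ fun x =>
    lift_mem_of_mem_freeComponent ha (hφ _ _ (ι_mem_freeComponent x))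

theorem isTIdeal_tIdealSpan (S : Set (FreeGraded F)) : IsTIdeal (tIdealSpan S) := by
  intro φ hφ f hf
  rw [tIdealSpan, TwoSidedIdeal.mem_sInf] at hf ⊢
  exact fun I hI => hI.1 φ hφ f (hf I hI)

theorem subset_tIdealSpan (S : Set (FreeGraded F)) : S ⊆ tIdealSpan S := by
  intro f hf
  rw [SetLike.mem_coe, tIdealSpan, TwoSidedIdeal.mem_sInf]
  exact fun I hI => hI.2 hf

theorem tIdealSpan_le {S : Set (FreeGraded F)} {I : TwoSidedIdeal (FreeGraded F)}
    (hI : IsTIdeal I) (hS : S ⊆ I) : tIdealSpan S ≤ I :=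
  sInf_le ⟨hI, hS⟩

theorem tIdealSpan_tripleCommutators_le_gradedIdentities (h : HasCentralCommutators A)
    (𝒜 : ℤ → Submodule F A) [GradedAlgebra 𝒜] :
    tIdealSpan (tripleCommutators F) ≤ gradedIdentities 𝒜 := by
  refine tIdealSpan_le (isTIdeal_gradedIdentities 𝒜) ?_
  rintro _ ⟨r, s, t, rfl⟩
  refine mem_gradedIdentities.mpr fun a _ => ?_
  simpa [Ring.lie_def, var] using h (a (r, 1)) (a (s, 2)) (a (t, 3))

theorem lie_lie_mem_tIdealSpan_tripleCommutators {r s t : ℤ} {f g h : FreeGraded F}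
    (hf : f ∈ freeComponent F r) (hg : g ∈ freeComponent F s) (hh : h ∈ freeComponent F t) :
    ⁅⁅f, g⁆, h⁆ ∈ tIdealSpan (tripleCommutators F) := by
  let v : ℤ × ℕ → FreeGraded F := fun x =>
    if x = (r, 1) then f else if x = (s, 2) then g else if x = (t, 3) then h
    else FreeAlgebra.ι F x
  have hv (x : ℤ × ℕ) : v x ∈ freeComponent F x.1 := by
    simp only [v]
    split_ifs with hx hx hx
    · exact hx ▸ hf
    · exact hx ▸ hg
    · exact hx ▸ hh
    · exact ι_mem_freeComponent x
  have hmem := isTIdeal_tIdealSpan (tripleCommutators F) _ (isGradedEnd_lift hv) _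
    (subset_tIdealSpan _ ⟨r, s, t, rfl⟩)
  simpa [Ring.lie_def, var, v] using hmem

theorem hasCentralCommutators_quotient :
    HasCentralCommutators (tIdealSpan (tripleCommutators F)).ringCon.Quotient := by
  let π := (tIdealSpan (tripleCommutators F)).ringCon.mkₐ (α := F)
  have span_eq_top : Submodule.span F
      (π '' Set.range fun l : List (ℤ × ℕ) => (l.map (FreeAlgebra.ι F)).prod) = ⊤ := by
    rw [← AlgHom.coe_toLinearMap π, Submodule.span_image, span_range_prod_ι_eq_top,
      Submodule.map_top, LinearMap.range_eq_top]
    exact RingCon.mk'_surjective _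
  have map_eq_zero {f : FreeGraded F} (hf : f ∈ tIdealSpan (tripleCommutators F)) : π f = 0 :=
    (RingCon.eq _).mpr hf
  refine hasCentralCommutators_of_span span_eq_top ?_
  rintro _ ⟨_, ⟨k, rfl⟩, rfl⟩ _ ⟨_, ⟨l, rfl⟩, rfl⟩ _ ⟨_, ⟨m, rfl⟩, rfl⟩
  have hmem := lie_lie_mem_tIdealSpan_tripleCommutators (F := F)
    (Submodule.subset_span ⟨k, rfl, rfl⟩) (Submodule.subset_span ⟨l, rfl, rfl⟩)
    (Submodule.subset_span ⟨m, rfl, rfl⟩)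
  simpa only [Ring.lie_def, map_sub, map_mul] using map_eq_zero hmem

theorem exists_sub_linearCombination_normalForm_mem_tIdealSpan (f : FreeGraded F) :
    ∃ c : NormalIndex (ℤ × ℕ) →₀ F,
      f - Finsupp.linearCombination F (normalForm (FreeAlgebra.ι F)) c ∈
        tIdealSpan (tripleCommutators F) := by
  let π := (tIdealSpan (tripleCommutators F)).ringCon.mkₐ (α := F)
  have lift_eq : FreeAlgebra.lift F (fun x => π (FreeAlgebra.ι F x)) = π := by ext x; simp
  obtain ⟨c, hc⟩ := (Finsupp.mem_span_range_iff_exists_finsupp).mp <|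
    hasCentralCommutators_quotient.lift_mem_span_normalForm (fun x => π (FreeAlgebra.ι F x)) f
  refine ⟨c, (TwoSidedIdeal.rel_iff _ _ _).mp ((RingCon.eq _).mp ?_)⟩
  change π f = π _
  rw [Finsupp.linearCombination_apply, map_finsuppSum, ← lift_eq, ← hc, lift_eq]
  simp only [map_smul, map_normalForm]

theorem lift_linearCombination_normalForm (u : ℤ × ℕ → A) (c : NormalIndex (ℤ × ℕ) →₀ F) :
    FreeAlgebra.lift F u (Finsupp.linearCombination F (normalForm (FreeAlgebra.ι F)) c) =
      Finsupp.linearCombination F (normalForm u) c := by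
  simp only [Finsupp.linearCombination_apply, map_finsuppSum, map_smul, map_normalForm,
    FreeAlgebra.lift_ι_apply]

theorem IsSupportSystem.generatesVarietyOf_tripleCommutators [CharZero F] {d : ℕ → ℤ}
    {S : ZMod 2 × (ℤ × ℕ) × ℕ → Finset ℕ} (hS : IsSupportSystem d S) :
    GeneratesVarietyOf (component F d) (tripleCommutators F) := by
  have hle := tIdealSpan_tripleCommutators_le_gradedIdentities (hasCentralCommutators_grassmann F)
    (component F d)
  refine le_antisymm hle fun f hf => ?_
  obtain ⟨c, hc⟩ := exists_sub_linearCombination_normalForm_mem_tIdealSpan f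
  obtain rfl : c = 0 := by
    refine hS.eq_zero_of_linearCombination_normalForm c fun u hu => ?_
    have hlift := mem_gradedIdentities.mp (hle hc) u hu
    rwa [map_sub, mem_gradedIdentities.mp hf u hu, zero_sub, neg_eq_zero,
      lift_linearCombination_normalForm] at hlift
  simpa only [map_zero, sub_zero] using hc

end GradedIdentities

section Degrees

variable {d : ℕ → ℤ} {m n : ℤ}

theorem IsTwoInduced.exists_disjoint_monomialDegree_eq (hd : IsTwoInduced d m n) (hmn : m ≠ n)
    (x y : ℕ) (t : Finset ℕ) :
    ∃ s : Finset ℕ, Disjoint s t ∧ s.card = x + y ∧ monomialDegree d s = x * m + y * n := by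
  obtain ⟨u, hu, hux⟩ := (hd.infinite_left.sdiff t.finite_toSet).exists_subset_card_eq x
  obtain ⟨v, hv, hvy⟩ := (hd.infinite_right.sdiff t.finite_toSet).exists_subset_card_eq y
  have huv : Disjoint u v := Finset.disjoint_left.mpr fun i hi hi' =>
    hmn ((hu hi).1.symm.trans (hv hi').1)
  refine ⟨u ∪ v, ?_, by rw [Finset.card_union_of_disjoint huv, hux, hvy], ?_⟩
  · rw [Finset.disjoint_union_left, Finset.disjoint_left, Finset.disjoint_left]
    exact ⟨fun i hi => (hu hi).2, fun i hi => (hv hi).2⟩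
  · rw [monomialDegree, Finset.sum_union huv, Finset.sum_congr rfl fun i hi => (hu hi).1,
      Finset.sum_congr rfl fun i hi => (hv hi).1]
    simp only [Finset.sum_const, hux, hvy, nsmul_eq_mul]

theorem odd_sub_of_isCoprime_of_even_mul (hcop : IsCoprime m n) (hmn : Even (m * n)) :
    Odd (n - m) := by
  obtain ⟨u, v, huv⟩ := hcop
  have not_both_even : ¬ (Even m ∧ Even n) := fun ⟨hm, hn⟩ =>
    Int.not_even_one (huv ▸ (hm.mul_left u).add (hn.mul_left v))
  rw [Int.odd_sub]
  grind

theorem exists_pos_nat_mul_add_mul_eq (hm : m < 0) (hn : 0 < n) (hcop : IsCoprime m n) (r : ℤ) :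
    ∃ x y : ℕ, 0 < x ∧ 0 < y ∧ x * m + y * n = r := by
  obtain ⟨u, v, huv⟩ := hcop
  obtain ⟨t, ht_left, ht_right, ht⟩ : ∃ t : ℤ, -(r * u) < t ∧ -(r * v) < t ∧ 0 < t :=
    ⟨|r * u| + |r * v| + 1, by grind, by grind, by positivity⟩
  have hx : 0 < r * u + t * n := by nlinarith
  have hy : 0 < r * v - t * m := by nlinarith
  refine ⟨(r * u + t * n).toNat, (r * v - t * m).toNat, by omega, by omega, ?_⟩
  rw [Int.toNat_of_nonneg hx.le, Int.toNat_of_nonneg hy.le]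
  linear_combination r * huv

theorem exists_nat_mul_add_mul_eq_and_cast_eq (hm : m < 0) (hn : 0 < n) (hcop : IsCoprime m n)
    (hmn : Even (m * n)) (r : ℤ) (ε : ZMod 2) :
    ∃ x y : ℕ, x * m + y * n = r ∧ ((x + y : ℕ) : ZMod 2) = ε ∧ 0 < x + y := by
  obtain ⟨x, y, hx, -, hxy⟩ := exists_pos_nat_mul_add_mul_eq hm hn hcop r
  by_cases hε : ((x + y : ℕ) : ZMod 2) = ε
  · exact ⟨x, y, hxy, hε, by omega⟩
  -- Adding `(n, -m)` preserves `x m + y n` and changes the parity of `x + y`.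
  lift n to ℕ using hn.le
  obtain ⟨m, rfl⟩ : ∃ k : ℕ, m = -k := ⟨(-m).toNat, by omega⟩
  have hodd : ((n + m : ℕ) : ZMod 2) = 1 := by
    have h := odd_sub_of_isCoprime_of_even_mul hcop hmn
    rw [sub_neg_eq_add] at h
    exact ZMod.natCast_eq_one_iff_odd.mpr (by exact_mod_cast h)
  refine ⟨x + n, y + m, by push_cast; linear_combination hxy, ?_, by omega⟩
  rw [add_add_add_comm, Nat.cast_add, hodd]
  generalize ((x + y : ℕ) : ZMod 2) = δ at hε
  revert δ ε
  decide

theorem IsTwoInduced.isAbundant (hd : IsTwoInduced d m n) (hm : m < 0) (hn : 0 < n)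
    (hcop : IsCoprime m n) (hmn : Even (m * n)) : IsAbundant d := by
  intro r ε t
  obtain ⟨x, y, hdeg, hparity, hpos⟩ := exists_nat_mul_add_mul_eq_and_cast_eq hm hn hcop hmn r ε
  obtain ⟨s, hst, hcard, hs⟩ := hd.exists_disjoint_monomialDegree_eq (hm.trans hn).ne x y t
  exact ⟨s, hst, Finset.card_pos.mp (hcard ▸ hpos), hs.trans hdeg, hcard ▸ hparity⟩

end Degrees

end GradedGrassmann

theorem theorem3p12_general {F : Type*} [Field F] [CharZero F] {d : ℕ → ℤ}
    (hd : GradedGrassmann.IsAbundant d) :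
    GradedGrassmann.GeneratesVarietyOf (GradedGrassmann.component F d)
      (GradedGrassmann.tripleCommutators F) ∧
    ∀ r : ℤ, ∃ W : Set (Finset ℕ), W.PairwiseDisjoint id ∧
      (∀ s ∈ W, GradedGrassmann.monomialBasis F s ∈ GradedGrassmann.component F d r) ∧
      {s ∈ W | Even s.card}.Infinite ∧ {s ∈ W | Odd s.card}.Infinite := by
  obtain ⟨S, hS⟩ := hd.exists_isSupportSystem
  exact ⟨hS.generatesVarietyOf_tripleCommutators, hS.exists_pairwiseDisjoint_infinite F⟩

theorem theorem3p12 {F : Type*} [Field F] [CharZero F] (m n : ℤ) (hm : m < 0) (hn : 0 < n)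
    (hmn : Even (m * n)) (α β α' β' : ℕ)
    (h_one : (1 : ℤ) = α * m + β * n) (h_neg_one : (-1 : ℤ) = α' * m + β' * n)
    (h_odd : Odd (α + β)) (h_odd' : Odd (α' + β'))
    (d : ℕ → ℤ) (hd : GradedGrassmann.IsTwoInduced d m n) :
    GradedGrassmann.GeneratesVarietyOf (GradedGrassmann.component F d)
      (GradedGrassmann.tripleCommutators F) ∧
    ∀ r : ℤ, ∃ W : Set (Finset ℕ), W.PairwiseDisjoint id ∧
      (∀ s ∈ W, GradedGrassmann.monomialBasis F s ∈ GradedGrassmann.component F d r) ∧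
      {s ∈ W | Even s.card}.Infinite ∧ {s ∈ W | Odd s.card}.Infinite := by
  exact theorem3p12_general (hd.isAbundant hm hn ⟨α, β, h_one.symm⟩ hmn)
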